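/- Let $G$ be a finite group and let $k$ be a field whose characteristic $p$ divides $|G|$. All modules are finitely generated left $kG$-modules. Let $\mathrm{stmod}(kG)$ be the stable module category: its objects are the (finitely generated) $kG$-modules and its morphisms are $\underline{\mathrm{Hom}}_{kG}(M,M')$, the $kG$-homomorphisms modulo those that factor through a projective module. Let $\Omega M$ be the kernel of a surjection from a projective module onto $M$, let $\Omega^{-1}M$ be the cokernel of an embedding of $M$ in a projective (equivalently, injective) module, and let $\Omega^i$, $i\in\mathbb Z$, be their iterates; these are well defined up to isomorphism in $\mathrm{stmod}(kG)$. The category $\mathrm{stmod}(kG)$ is triangulated, with suspension $\Omega^{-1}$ and with distinguished triangles those isomorphic to the ones given by short exact sequences of modules. Let $\mathrm{thick}_G(k)$ be the smallest full subcategory of $\mathrm{stmod}(kG)$ that contains the trivial module $k$ and is closed under exact triangles (if two of the three objects of a distinguished triangle belong to it, so does the third) and under direct summands. Put $\hat H^i(G,M)=\underline{\mathrm{Hom}}_{kG}(\Omega^i k,M)$ for $i\in\mathbb Z$. A *ghost* in $\mathrm{thick}_G(k)$ is a map in $\mathrm{stmod}(kG)$ between objects of $\mathrm{thick}_G(k)$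 that induces the zero map on $\hat H^*(G,-)$. The *generating hypothesis* (GH) for $kG$ states that $\hat H^*(G,-)$ is faithful on $\mathrm{thick}_G(k)$, that is, that every ghost in $\mathrm{thick}_G(k)$ is zero in $\mathrm{stmod}(kG)$. A short exact sequence $0\to A\to B\to C\to 0$ of modules is *almost split* if it does not split, $A$ and $C$ are indecomposable, and every map $M\to C$ that is not a split epimorphism factors through $B\to C$. **Corollary 2.2.** Suppose that $\mathrm{thick}_G(k)$ contains an indecomposable non-projective module $N$ such that $N\not\cong\Omega^i k$ in $\mathrm{stmod}(kG)$ for every $i\in\mathbb Z$. Then the GH fails for $kG$. More precisely, there is an almost split sequence ending in $N$; every almost split sequence $0\to A\to B\to N\to 0$ has $A\cong\Omega^2N$ in $\mathrm{stmod}(kG)$, and so gives a distinguished triangle $$\Omega^2N\longrightarrow B\longrightarrow N\overset{\phi}{\longrightarrow}\Omega N;$$ and, for every choice of the isomorphism $A\cong\Omega^2N$, the connecting map $\phi$ is a ghost in $\mathrm{thick}_G(k)$ that is non-zero in $\mathrm{stmod}(kG)$. -/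

import Mathlib

open CategoryTheory

universe u

noncomputable section

namespace StableModule

section Ring

variable {R : Type u} [Ring R]

/-- Two homomorphisms of finitely generated modules are stably equal if their difference factors
through a finitely generated projective module. -/
def stableRel (R : Type u) [Ring R] : HomRel (FGModuleCat.{u} R) := fun M N f g =>
  ∃ (P : FGModuleCat.{u} R) (a : M ⟶ P) (b : P ⟶ N), Module.Projective R P ∧ f - g = a ≫ b

theorem stableRel_add ⦃M N : FGModuleCat.{u} R⦄ (f₁ f₂ g₁ g₂ : M ⟶ N)
    (hf : stableRel R f₁ f₂) (hg : stableRel R g₁ g₂) : stableRel R (f₁ + g₁) (f₂ + g₂) := by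
  obtain ⟨P, a, b, hP, h⟩ := hf
  obtain ⟨Q, c, d, hQ, h'⟩ := hg
  refine ⟨FGModuleCat.of R (P × Q), FGModuleCat.ofHom (a.hom.hom.prod c.hom.hom),
    FGModuleCat.ofHom (b.hom.hom.coprod d.hom.hom), ?_, ?_⟩
  · exact inferInstanceAs (Module.Projective R (P × Q))
  · have e : f₁ + g₁ - (f₂ + g₂) = a ≫ b + c ≫ d := by rw [← h, ← h']; abel
    rw [e]
    ext x
    rfl

instance : Congruence (stableRel R) where
  equivalence :=
    { refl := fun f => ⟨FGModuleCat.of R PUnit.{u + 1}, 0, 0,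
        inferInstanceAs (Module.Projective R PUnit.{u + 1}), by simp⟩
      symm := by
        rintro f g ⟨P, a, b, hP, h⟩
        exact ⟨P, a, -b, hP, by rw [Preadditive.comp_neg, ← h]; abel⟩
      trans := by
        intro f g h h₁ h₂
        obtain ⟨P, a, b, hP, e⟩ := stableRel_add f g g h h₁ h₂
        exact ⟨P, a, b, hP, by rw [← e]; abel⟩ }
  comp_left := by
    rintro X Y Z f g g' ⟨P, a, b, hP, h⟩
    exact ⟨P, f ≫ a, b, hP, by rw [← Preadditive.comp_sub, h, Category.assoc]⟩
  comp_right := by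
    rintro X Y Z f f' g ⟨P, a, b, hP, h⟩
    exact ⟨P, a, b ≫ g, hP, by rw [← Preadditive.sub_comp, h, Category.assoc]⟩

/-- The stable module category `stmod(R)`: finitely generated modules, with homomorphisms modulo
those that factor through a projective module. -/
abbrev StMod (R : Type u) [Ring R] : Type (u + 1) := Quotient (stableRel R)

instance : Preadditive (StMod R) := Quotient.preadditive (stableRel R) stableRel_add

/-- The quotient functor from finitely generated modules to the stable module category. -/
abbrev toSt (R : Type u) [Ring R] : FGModuleCat.{u} R ⥤ StMod R := Quotient.functor (stableRel R)

/-- `0 ⟶ A ⟶ B ⟶ C ⟶ 0` is a short exact sequence of modules. -/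
structure IsShortExact {A B C : FGModuleCat.{u} R} (f : A ⟶ B) (g : B ⟶ C) : Prop where
  injective : Function.Injective f.hom.hom
  exact : Function.Exact f.hom.hom g.hom.hom
  surjective : Function.Surjective g.hom.hom

/-- A module is indecomposable if it is nonzero and is not the internal direct sum of two nonzero
submodules. -/
def IsIndecomposable (M : FGModuleCat.{u} R) : Prop :=
  Nontrivial M ∧ ∀ U V : Submodule R M, IsCompl U V → U = ⊥ ∨ V = ⊥

/-- Almost split (Auslander-Reiten) sequences of finitely generated modules. -/
structure IsAlmostSplit {A B C : FGModuleCat.{u} R} (f : A ⟶ B) (g : B ⟶ C) : Prop where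
  shortExact : IsShortExact f g
  indecomposable_left : IsIndecomposable A
  indecomposable_right : IsIndecomposable C
  not_split : ¬ ∃ s : C ⟶ B, s ≫ g = 𝟙 C
  exists_lift : ∀ (M : FGModuleCat.{u} R) (h : M ⟶ C),
    (¬ ∃ s : C ⟶ M, s ≫ h = 𝟙 C) → ∃ h' : M ⟶ B, h' ≫ g = h

/-- Connecting maps. Let `0 ⟶ A ⟶ B ⟶ C ⟶ 0` and `0 ⟶ A' ⟶ P ⟶ S ⟶ 0` be the short exact
sequences given by `f, g` and `i, q`, where `P` is projective (and injective), so that `S` is a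
suspension of `A'`. The connecting map of the first sequence, followed by the suspension of
`θ : A ⟶ A'`, is the stable map `δ : C ⟶ S` obtained by completing a representative of `θ` to a
map of short exact sequences. -/
def IsConnectingMap {A B C A' P S : FGModuleCat.{u} R} (f : A ⟶ B) (g : B ⟶ C)
    (i : A' ⟶ P) (q : P ⟶ S) (θ : (toSt R).obj A ⟶ (toSt R).obj A')
    (δ : (toSt R).obj C ⟶ (toSt R).obj S) : Prop :=
  ∃ (α : A ⟶ A') (β : B ⟶ P) (γ : C ⟶ S),
    f ≫ β = α ≫ i ∧ g ≫ γ = β ≫ q ∧ (toSt R).map α = θ ∧ (toSt R).map γ = δ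

/-- The number of generators of a chosen free cover of `M`. -/
def coverRank (M : FGModuleCat.{u} R) : ℕ := (Module.Finite.exists_fin' R M).choose

/-- A chosen surjection from a finitely generated free module onto `M`. -/
def coverMap (M : FGModuleCat.{u} R) : (Fin (coverRank M) → R) →ₗ[R] M :=
  (Module.Finite.exists_fin' R M).choose_spec.choose

theorem coverMap_surjective (M : FGModuleCat.{u} R) : Function.Surjective (coverMap M) :=
  (Module.Finite.exists_fin' R M).choose_spec.choose_spec

/-- The chosen free cover of `M`, as an object. -/
abbrev cover (M : FGModuleCat.{u} R) : FGModuleCat.{u} R :=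
  FGModuleCat.of R (Fin (coverRank M) → R)

/-- `Ω M`, the kernel of a surjection from a finitely generated projective module onto `M`;
in the stable category it does not depend on the surjection. -/
def syzygy [IsNoetherianRing R] (M : FGModuleCat.{u} R) : FGModuleCat.{u} R :=
  FGModuleCat.of R (LinearMap.ker (coverMap M))

/-- The inclusion of `Ω M` in the chosen free cover of `M`. -/
def syzygyι [IsNoetherianRing R] (M : FGModuleCat.{u} R) : syzygy M ⟶ cover M :=
  FGModuleCat.ofHom (LinearMap.ker (coverMap M)).subtype

/-- The projection of the chosen free cover of `M` onto `M`. -/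
def coverπ (M : FGModuleCat.{u} R) : cover M ⟶ M := FGModuleCat.ofHom (coverMap M)

end Ring

section GroupAlgebra

variable {k G : Type u} [Field k] [Group G] [Finite G]

instance : IsNoetherianRing (MonoidAlgebra k G) :=
  have : Module.Finite k (MonoidAlgebra k G) := inferInstance
  IsNoetherianRing.of_finite k (MonoidAlgebra k G)

/-- Every finitely generated `kG`-module embeds in a finitely generated free one. -/
theorem exists_embedding (M : FGModuleCat.{u} (MonoidAlgebra k G)) :
    ∃ (n : ℕ) (f : M →ₗ[MonoidAlgebra k G] (Fin n → MonoidAlgebra k G)),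
      Function.Injective f := by
  classical
  have := Fintype.ofFinite G
  let _ : Module k M := Module.compHom M (algebraMap k (MonoidAlgebra k G))
  have tower : IsScalarTower k (MonoidAlgebra k G) M := IsScalarTower.of_algebraMap_smul fun _ _ => rfl
  have : Module.Finite k M := Module.Finite.trans (MonoidAlgebra k G) M
  let b := Module.finBasis k M
  let F (i : Fin (Module.finrank k M)) : M →ₗ[MonoidAlgebra k G] MonoidAlgebra k G :=
    { toFun := fun m =>
        ∑ g : G, MonoidAlgebra.single g (b.coord i (MonoidAlgebra.single g⁻¹ (1 : k) • m))
      map_add' := by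
        intro x y
        simp only [smul_add, map_add, MonoidAlgebra.single_add, Finset.sum_add_distrib]
      map_smul' := by
        intro a m
        simp only [RingHom.id_apply]
        induction a using MonoidAlgebra.induction_linear with
        | zero => simp
        | add x y hx hy =>
          simp only [add_smul, smul_add, map_add, MonoidAlgebra.single_add,
            Finset.sum_add_distrib, hx, hy]
        | single h r =>
          rw [smul_eq_mul, Finset.mul_sum, ← Equiv.sum_comp (Equiv.mulLeft h)]
          refine Finset.sum_congr rfl fun g _ => ?_
          have e : MonoidAlgebra.single (h * g)⁻¹ (1 : k) • MonoidAlgebra.single h r • m =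
              r • (MonoidAlgebra.single g⁻¹ (1 : k) • m) := by
            rw [smul_smul, ← smul_assoc, MonoidAlgebra.single_mul_single,
              MonoidAlgebra.smul_single]
            simp
          simp only [Equiv.coe_mulLeft]
          rw [e, MonoidAlgebra.single_mul_single, map_smul, smul_eq_mul] }
  refine ⟨Module.finrank k M, LinearMap.pi F, ?_⟩
  rw [injective_iff_map_eq_zero]
  intro m hm
  refine (Module.Basis.forall_coord_eq_zero_iff b).1 fun i => ?_
  have h := congrArg (fun v : MonoidAlgebra k G => v.coeff 1) (congrFun hm i)
  simpa [F, Finsupp.single_apply, MonoidAlgebra.coeff_sum, ← MonoidAlgebra.one_def] using h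

/-- The rank of a chosen free module that contains `M`. -/
def hullRank (M : FGModuleCat.{u} (MonoidAlgebra k G)) : ℕ := (exists_embedding M).choose

/-- A chosen embedding of `M` in a finitely generated free module (which is also injective). -/
def hullMap (M : FGModuleCat.{u} (MonoidAlgebra k G)) :
    M →ₗ[MonoidAlgebra k G] (Fin (hullRank M) → MonoidAlgebra k G) :=
  (exists_embedding M).choose_spec.choose

theorem hullMap_injective (M : FGModuleCat.{u} (MonoidAlgebra k G)) :
    Function.Injective (hullMap M) :=
  (exists_embedding M).choose_spec.choose_spec

/-- The chosen free module that contains `M`, as an object. -/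
abbrev hull (M : FGModuleCat.{u} (MonoidAlgebra k G)) : FGModuleCat.{u} (MonoidAlgebra k G) :=
  FGModuleCat.of (MonoidAlgebra k G) (Fin (hullRank M) → MonoidAlgebra k G)

/-- `Ω⁻¹ M`, the cokernel of an embedding of `M` in a finitely generated projective (equivalently,
injective) module. It is the suspension of `M` in the stable category. -/
def cosyzygy (M : FGModuleCat.{u} (MonoidAlgebra k G)) : FGModuleCat.{u} (MonoidAlgebra k G) :=
  FGModuleCat.of (MonoidAlgebra k G)
    ((Fin (hullRank M) → MonoidAlgebra k G) ⧸ LinearMap.range (hullMap M))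

/-- The embedding of `M` in the chosen free module. -/
def hullι (M : FGModuleCat.{u} (MonoidAlgebra k G)) : M ⟶ hull M :=
  FGModuleCat.ofHom (hullMap M)

/-- The projection of the chosen free module that contains `M` onto `Ω⁻¹ M`. -/
def cosyzygyπ (M : FGModuleCat.{u} (MonoidAlgebra k G)) : hull M ⟶ cosyzygy M :=
  FGModuleCat.ofHom (LinearMap.range (hullMap M)).mkQ

/-- `Ωⁱ M` for an integer `i`. -/
def omega : ℤ → FGModuleCat.{u} (MonoidAlgebra k G) → FGModuleCat.{u} (MonoidAlgebra k G)
  | Int.ofNat n, M => syzygy^[n] M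
  | Int.negSucc n, M => cosyzygy^[n + 1] M

/-- The distinguished triangles `X ⟶ Y ⟶ Z ⟶ Ω⁻¹ X` of the stable module category: those that are
isomorphic to the triangle of a short exact sequence of finitely generated modules. -/
def IsDistinguished {X Y Z : FGModuleCat.{u} (MonoidAlgebra k G)}
    (a : (toSt (MonoidAlgebra k G)).obj X ⟶ (toSt (MonoidAlgebra k G)).obj Y)
    (b : (toSt (MonoidAlgebra k G)).obj Y ⟶ (toSt (MonoidAlgebra k G)).obj Z)
    (c : (toSt (MonoidAlgebra k G)).obj Z ⟶ (toSt (MonoidAlgebra k G)).obj (cosyzygy X)) :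
    Prop :=
  ∃ (A B C : FGModuleCat.{u} (MonoidAlgebra k G)) (f : A ⟶ B) (g : B ⟶ C)
    (eA : (toSt _).obj A ≅ (toSt _).obj X) (eB : (toSt _).obj B ≅ (toSt _).obj Y)
    (eC : (toSt _).obj C ≅ (toSt _).obj Z),
    IsShortExact f g ∧ (toSt _).map f ≫ eB.hom = eA.hom ≫ a ∧
      (toSt _).map g ≫ eC.hom = eB.hom ≫ b ∧
      IsConnectingMap f g (hullι X) (cosyzygyπ X) eA.hom (eC.hom ≫ c)

/-- A full subcategory of `stmod(kG)` is thick if it is closed under direct summands and under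
exact triangles: if two of the three objects of a distinguished triangle belong to it, so does
the third. -/
structure IsThick (T : ObjectProperty (StMod (MonoidAlgebra k G))) : Prop where
  retracts : T.IsStableUnderRetracts
  triangle₁ : ∀ {X Y Z : FGModuleCat.{u} (MonoidAlgebra k G)} (a : (toSt _).obj X ⟶ (toSt _).obj Y)
    (b : (toSt _).obj Y ⟶ (toSt _).obj Z) (c : (toSt _).obj Z ⟶ (toSt _).obj (cosyzygy X)),
    IsDistinguished a b c → T ((toSt _).obj Y) → T ((toSt _).obj Z) → T ((toSt _).obj X)
  triangle₂ : ∀ {X Y Z : FGModuleCat.{u} (MonoidAlgebra k G)} (a : (toSt _).obj X ⟶ (toSt _).obj Y)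
    (b : (toSt _).obj Y ⟶ (toSt _).obj Z) (c : (toSt _).obj Z ⟶ (toSt _).obj (cosyzygy X)),
    IsDistinguished a b c → T ((toSt _).obj X) → T ((toSt _).obj Z) → T ((toSt _).obj Y)
  triangle₃ : ∀ {X Y Z : FGModuleCat.{u} (MonoidAlgebra k G)} (a : (toSt _).obj X ⟶ (toSt _).obj Y)
    (b : (toSt _).obj Y ⟶ (toSt _).obj Z) (c : (toSt _).obj Z ⟶ (toSt _).obj (cosyzygy X)),
    IsDistinguished a b c → T ((toSt _).obj X) → T ((toSt _).obj Y) → T ((toSt _).obj Z)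

variable (k G)

/-- The trivial module `k`. -/
def trivialModule : FGModuleCat.{u} (MonoidAlgebra k G) :=
  have : Module.Finite (MonoidAlgebra k G) (Representation.trivial k G k).asModule :=
    Module.Finite.of_restrictScalars_finite k _ _
  FGModuleCat.of (MonoidAlgebra k G) (Representation.trivial k G k).asModule

/-- `thick_G(k)`, the smallest thick subcategory of `stmod(kG)` that contains `k`. -/
def thickSubcategory : ObjectProperty (StMod (MonoidAlgebra k G)) := fun X =>
  ∀ T : ObjectProperty (StMod (MonoidAlgebra k G)),
    IsThick T → T ((toSt _).obj (trivialModule k G)) → T X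

/-- Tate cohomology in degree `i`, as the functor of stable maps from `Ωⁱ k`. -/
def tateCohomology (i : ℤ) : StMod (MonoidAlgebra k G) ⥤ AddCommGrpCat.{u} :=
  preadditiveCoyoneda.obj (Opposite.op ((toSt _).obj (omega i (trivialModule k G))))

/-- The Tate cohomology functor `Ĥ^*(G, -)`, with values in graded abelian groups. -/
def totalTateCohomology : StMod (MonoidAlgebra k G) ⥤ GradedObject ℤ AddCommGrpCat.{u} :=
  Functor.pi' (tateCohomology k G)

/-- The generating hypothesis for `kG`: Tate cohomology is faithful on `thick_G(k)`. -/
def GeneratingHypothesis : Prop :=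
  ((thickSubcategory k G).ι ⋙ totalTateCohomology k G).Faithful

variable {k G}

/-- A ghost in `thick_G(k)`: a map between objects of `thick_G(k)` that induces the zero map in
Tate cohomology. -/
structure IsGhost {X Y : StMod (MonoidAlgebra k G)} (φ : X ⟶ Y) : Prop where
  source_mem : thickSubcategory k G X
  target_mem : thickSubcategory k G Y
  tate_map_eq_zero : (totalTateCohomology k G).map φ = 0

/-- `φ : C ⟶ Ω C` is the third map of a triangle `Ω² C ⟶ B ⟶ C ⟶ Ω C` that comes from the short
exact sequence `0 ⟶ A ⟶ B ⟶ C ⟶ 0` given by `f, g` and a stable isomorphism `A ≅ Ω² C`. The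
suspension of `Ω² C` is identified with `Ω C` by the sequence `0 ⟶ Ω² C ⟶ P ⟶ Ω C ⟶ 0` that
defines `Ω² C`. -/
def IsTriangleMap {A B C : FGModuleCat.{u} (MonoidAlgebra k G)} (f : A ⟶ B) (g : B ⟶ C)
    (φ : (toSt (MonoidAlgebra k G)).obj C ⟶ (toSt (MonoidAlgebra k G)).obj (omega 1 C)) : Prop :=
  ∃ θ : (toSt (MonoidAlgebra k G)).obj A ≅ (toSt (MonoidAlgebra k G)).obj (omega 2 C),
    IsConnectingMap f g (syzygyι (omega 1 C)) (coverπ (omega 1 C)) θ.hom φ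

end GroupAlgebra

end StableModule

end

/-! A Tate class of `N` is a stable map from some Ωⁱk to `N`. A representative that is a split
epimorphism would make `N` a stable retract of Ωⁱk. Every endomorphism of Ωⁱk is stably invertible
or stably nilpotent, so such a retract is the whole of Ωⁱk, which is excluded. The representative
therefore lifts to the middle term of the almost split sequence, and the connecting map kills it
(`IsAlmostSplit.comp_isTriangleMap`). If the connecting map were stably zero, the sequence would
split (`IsAlmostSplit.isTriangleMap_ne_zero`).

Existence rests on kG being a symmetric algebra. A linear form on End(N) that kills the
non-automorphisms but not the identity is written, through the trace form on free modules, as a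
stably non-zero map N → ΩN. This map becomes stably zero after composition with any map to `N` that
is not a split epimorphism (`exists_almostVanishing`). Pulling back the cover of ΩN along it gives a
right almost split map with kernel Ω²N. That kernel may have projective summands, since the covers
are not minimal; decomposable kernels are cut down by induction on length
(`IsRightAlmostSplit.exists_isAlmostSplit`).

For the same reason Ω²N is compared with the left-hand term of an arbitrary almost split sequence by
means of `IsStablyLocal`, a property that Ω preserves, and not by indecomposability. -/

noncomputable section

namespace StableModule

/-! ### Endomorphisms of indecomposable modules of finite length -/

section Fitting

variable {R M : Type*} [Ring R] [AddCommGroup M] [Module R M]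

/-- Fitting's lemma. -/
theorem bijective_or_isNilpotent [IsNoetherian R M] [IsArtinian R M]
    (hM : ∀ U V : Submodule R M, IsCompl U V → U = ⊥ ∨ V = ⊥) (f : Module.End R M) :
    Function.Bijective f ∨ IsNilpotent f := by
  obtain ⟨n, hn⟩ := Filter.eventually_atTop.1 (f.eventually_isCompl_ker_pow_range_pow)
  -- The exponent must be positive, so that a factor `f` can be split off on either side of the
  -- power.
  have h := hn (n + 1) (by omega)
  rcases hM _ _ h with h0 | h0
  · left
    have hr : LinearMap.range (f ^ (n + 1)) = ⊤ := by
      have := h.sup_eq_top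
      rwa [h0, bot_sup_eq] at this
    constructor
    · have := LinearMap.ker_eq_bot.1 h0
      rw [pow_succ] at this
      exact Function.Injective.of_comp (f := ⇑(f ^ n)) this
    · have := LinearMap.range_eq_top.1 hr
      rw [pow_succ'] at this
      exact Function.Surjective.of_comp (g := ⇑(f ^ n)) this
  · right
    exact ⟨n + 1, LinearMap.range_eq_bot.1 h0⟩

/-- The endomorphisms that are not bijective are closed under addition. -/
theorem not_bijective_add [IsNoetherian R M] [IsArtinian R M]
    (hM : ∀ U V : Submodule R M, IsCompl U V → U = ⊥ ∨ V = ⊥) {f g : Module.End R M}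
    (hf : ¬ Function.Bijective f) (hg : ¬ Function.Bijective g) :
    ¬ Function.Bijective (f + g) := by
  intro hfg
  simp only [← Module.End.isUnit_iff] at hf hg hfg
  obtain ⟨u, hu⟩ := hfg
  -- Normalise the sum to 1: the first summand is nilpotent by Fitting, so the second is a unit, a
  -- contradiction.
  have key : (↑u⁻¹ * f) + (↑u⁻¹ * g) = 1 := by rw [← mul_add, ← hu, Units.inv_mul]
  have h : ¬ Function.Bijective (↑u⁻¹ * f : Module.End R M) := by
    rw [← Module.End.isUnit_iff]
    simpa using hf
  have := ((bijective_or_isNilpotent hM _).resolve_left h).isUnit_one_sub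
  rw [← key, add_sub_cancel_left] at this
  exact hg (by simpa using this)

end Fitting

/-! ### The symmetrizing form of kG and trace duality -/

section Trace

variable {k G : Type*} [Field k] [Group G]
  {X Y : Type*} [AddCommGroup X] [Module k X] [Module (MonoidAlgebra k G) X]
  [IsScalarTower k (MonoidAlgebra k G) X]
  [AddCommGroup Y] [Module k Y] [Module (MonoidAlgebra k G) Y]
  [IsScalarTower k (MonoidAlgebra k G) Y]

/-- The linear form on the group algebra that takes the coefficient of the identity. -/
def coeffOne (k G : Type*) [Field k] [Group G] : MonoidAlgebra k G →ₗ[k] k where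
  toFun x := x.coeff 1
  map_add' _ _ := rfl
  map_smul' _ _ := rfl

theorem coeffOne_mul_comm (x y : MonoidAlgebra k G) :
    coeffOne k G (x * y) = coeffOne k G (y * x) := by
  induction x using MonoidAlgebra.induction_linear with
  | zero => simp
  | add a b ha hb => simp only [add_mul, mul_add, map_add, ha, hb]
  | single g r =>
    change (_ : MonoidAlgebra k G).coeff 1 = (_ : MonoidAlgebra k G).coeff 1
    rw [MonoidAlgebra.coeff_single_mul_apply, MonoidAlgebra.coeff_mul_single_apply]
    simp [mul_comm]

/-- Translating the argument by g⁻¹ moves the coefficient at g to the identity, so the coefficient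
at 1 determines a kG-map. -/
theorem eq_of_coeffOne_eq {X : Type*} [AddCommGroup X] [Module (MonoidAlgebra k G) X]
    {u v : X →ₗ[MonoidAlgebra k G] MonoidAlgebra k G}
    (h : ∀ x, coeffOne k G (u x) = coeffOne k G (v x)) : u = v := by
  ext x g
  have := h (MonoidAlgebra.single g⁻¹ (1 : k) • x)
  simp only [map_smul, smul_eq_mul] at this
  change (_ : MonoidAlgebra k G).coeff 1 = (_ : MonoidAlgebra k G).coeff 1 at this
  simpa [MonoidAlgebra.coeff_single_mul_apply] using this

theorem single_smul_comm (g : G) (r : k) (x : X) :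
    MonoidAlgebra.single g r • x = r • (MonoidAlgebra.single g (1 : k) • x) := by
  rw [← smul_assoc, MonoidAlgebra.smul_single]
  simp

/-- The trace form on the endomorphisms of a free module. -/
def traceForm {n : ℕ} (f : (Fin n → MonoidAlgebra k G) →ₗ[MonoidAlgebra k G]
    (Fin n → MonoidAlgebra k G)) : k :=
  ∑ i, coeffOne k G (f (Pi.single i 1) i)

theorem map_eq_sum {Λ Z : Type*} [Ring Λ] [AddCommGroup Z] [Module Λ Z] {n : ℕ}
    (a : (Fin n → Λ) →ₗ[Λ] Z) (v : Fin n → Λ) : a v = ∑ i, v i • a (Pi.single i 1) := by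
  conv_lhs => rw [← Finset.univ_sum_single v, map_sum]
  refine Finset.sum_congr rfl fun i _ => ?_
  rw [← map_smul]
  congr 1
  ext j
  by_cases h : j = i
  · subst h; simp
  · simp [h]

/-- The homomorphism from a free module that maps one basis vector to `x` and the others to
zero. -/
def coordHom {Λ Z : Type*} [Ring Λ] [AddCommGroup Z] [Module Λ Z] {n : ℕ} (i : Fin n) (x : Z) :
    (Fin n → Λ) →ₗ[Λ] Z :=
  LinearMap.toSpanSingleton Λ Z x ∘ₗ LinearMap.proj i

theorem coordHom_apply {Λ Z : Type*} [Ring Λ] [AddCommGroup Z] [Module Λ Z] {n : ℕ} (i : Fin n)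
    (x : Z) (v : Fin n → Λ) : coordHom i x v = v i • x :=
  rfl

/-- Matrix multiplication together with the symmetry of `coeffOne`; this is where kG being
symmetric, and not just Frobenius, enters. -/
theorem traceForm_comp_comm {n m : ℕ}
    (a : (Fin n → MonoidAlgebra k G) →ₗ[MonoidAlgebra k G] (Fin m → MonoidAlgebra k G))
    (b : (Fin m → MonoidAlgebra k G) →ₗ[MonoidAlgebra k G] (Fin n → MonoidAlgebra k G)) :
    traceForm (b ∘ₗ a) = traceForm (a ∘ₗ b) := by
  simp only [traceForm, LinearMap.comp_apply]
  have h1 (i : Fin n) : b (a (Pi.single i 1)) i =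
      ∑ j, a (Pi.single i 1) j * b (Pi.single j 1) i := by
    rw [map_eq_sum b]; simp
  have h2 (j : Fin m) : a (b (Pi.single j 1)) j =
      ∑ i, b (Pi.single j 1) i * a (Pi.single i 1) j := by
    rw [map_eq_sum a]; simp
  simp only [h1, h2, map_sum]
  rw [Finset.sum_comm]
  exact Finset.sum_congr rfl fun j _ => Finset.sum_congr rfl fun i _ => coeffOne_mul_comm _ _

/-- Nondegeneracy on one side of the trace pairing, tested on the maps `coordHom i x`. -/
theorem eq_of_traceForm_comp_eq {n : ℕ} {X : Type*} [AddCommGroup X] [Module (MonoidAlgebra k G) X]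
    {u v : X →ₗ[MonoidAlgebra k G] (Fin n → MonoidAlgebra k G)}
    (h : ∀ a : (Fin n → MonoidAlgebra k G) →ₗ[MonoidAlgebra k G] X,
      traceForm (u ∘ₗ a) = traceForm (v ∘ₗ a)) : u = v := by
  have key (i : Fin n) : LinearMap.proj i ∘ₗ u = LinearMap.proj i ∘ₗ v := by
    refine eq_of_coeffOne_eq fun x => ?_
    have e (w : X →ₗ[MonoidAlgebra k G] (Fin n → MonoidAlgebra k G)) :
        traceForm (w ∘ₗ coordHom i x) = coeffOne k G (w x i) := by
      rw [traceForm, Finset.sum_eq_single i]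
      · simp [coordHom_apply]
      · intro j _ hj
        simp [coordHom_apply, Pi.single_eq_of_ne (Ne.symm hj)]
      · simp
    simpa [e] using h (coordHom i x)
  exact LinearMap.ext fun x => funext fun i => LinearMap.congr_fun (key i) x

variable [Finite G]

/-- The homomorphism to the group algebra that corresponds to a linear form. -/
def ofLinearForm (χ : X →ₗ[k] k) : X →ₗ[MonoidAlgebra k G] MonoidAlgebra k G :=
  letI := Fintype.ofFinite G
  { toFun := fun x => ∑ g : G, MonoidAlgebra.single g (χ (MonoidAlgebra.single g⁻¹ (1 : k) • x))
    map_add' := by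
      intro x y
      simp only [smul_add, map_add, MonoidAlgebra.single_add, Finset.sum_add_distrib]
    map_smul' := by
      intro a m
      simp only [RingHom.id_apply]
      induction a using MonoidAlgebra.induction_linear with
      | zero => simp
      | add x y hx hy =>
        simp only [add_smul, smul_add, map_add, MonoidAlgebra.single_add,
          Finset.sum_add_distrib, hx, hy]
      | single h r =>
        rw [smul_eq_mul, Finset.mul_sum, ← Equiv.sum_comp (Equiv.mulLeft h)]
        refine Finset.sum_congr rfl fun g _ => ?_
        have e : MonoidAlgebra.single (h * g)⁻¹ (1 : k) • MonoidAlgebra.single h r • m =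
            r • (MonoidAlgebra.single g⁻¹ (1 : k) • m) := by
          rw [smul_smul, MonoidAlgebra.single_mul_single, single_smul_comm]
          simp
        simp only [Equiv.coe_mulLeft]
        rw [e, MonoidAlgebra.single_mul_single, map_smul, smul_eq_mul] }

/-- Together with `eq_of_coeffOne_eq` this identifies the k-dual of `X` with Hom(X, kG). -/
theorem coeffOne_ofLinearForm (χ : X →ₗ[k] k) (x : X) :
    coeffOne k G (ofLinearForm χ x) = χ x := by
  classical
  let _ := Fintype.ofFinite G
  change (_ : MonoidAlgebra k G).coeff 1 = _
  simp [ofLinearForm, Finsupp.single_apply, MonoidAlgebra.coeff_sum, ← MonoidAlgebra.one_def]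

/-- Self-injectivity of kG: maps to kG are linear forms, and linear forms extend along a k-linear
retraction of `f`. -/
theorem exists_extension {n : ℕ} (f : X →ₗ[MonoidAlgebra k G] Y) (hf : Function.Injective f)
    (u : X →ₗ[MonoidAlgebra k G] (Fin n → MonoidAlgebra k G)) :
    ∃ v : Y →ₗ[MonoidAlgebra k G] (Fin n → MonoidAlgebra k G), v ∘ₗ f = u := by
  obtain ⟨r, hr⟩ := LinearMap.exists_leftInverse_of_injective (f.restrictScalars k)
    (LinearMap.ker_eq_bot.2 hf)
  have hr' (x : X) : r (f x) = x := LinearMap.congr_fun hr x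
  refine ⟨LinearMap.pi fun i => ofLinearForm
    (coeffOne k G ∘ₗ ((LinearMap.proj i ∘ₗ u).restrictScalars k) ∘ₗ r), ?_⟩
  have h (i : Fin n) : ofLinearForm (coeffOne k G ∘ₗ
      ((LinearMap.proj i ∘ₗ u).restrictScalars k) ∘ₗ r) ∘ₗ f = LinearMap.proj i ∘ₗ u :=
    eq_of_coeffOne_eq fun x => by simp [coeffOne_ofLinearForm, hr']
  exact LinearMap.ext fun x => funext fun i => LinearMap.congr_fun (h i) x

/-- Every linear form on the homomorphisms from a free module is given by the trace pairing. -/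
theorem exists_eq_traceForm {n : ℕ}
    (χ : ((Fin n → MonoidAlgebra k G) →ₗ[MonoidAlgebra k G] X) →ₗ[k] k) :
    ∃ ψ : X →ₗ[MonoidAlgebra k G] (Fin n → MonoidAlgebra k G), ∀ a, χ a = traceForm (ψ ∘ₗ a) := by
  let e (i : Fin n) : X →ₗ[k] ((Fin n → MonoidAlgebra k G) →ₗ[MonoidAlgebra k G] X) :=
    { toFun := fun x => coordHom i x
      map_add' := fun x y => LinearMap.ext fun v => smul_add (v i) x y
      map_smul' := fun r x => LinearMap.ext fun v => smul_comm (v i) r x }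
  refine ⟨LinearMap.pi fun i => ofLinearForm (χ ∘ₗ e i), fun a => ?_⟩
  have h : a = ∑ i, e i (a (Pi.single i 1)) := by
    refine LinearMap.ext fun v => ?_
    rw [map_eq_sum a]
    simp [e, coordHom_apply]
  conv_lhs => rw [h, map_sum]
  simp [traceForm, coeffOne_ofLinearForm]

theorem eq_zero_of_traceForm_comp {n : ℕ}
    {a : (Fin n → MonoidAlgebra k G) →ₗ[MonoidAlgebra k G] X}
    (h : ∀ u : X →ₗ[MonoidAlgebra k G] (Fin n → MonoidAlgebra k G), traceForm (u ∘ₗ a) = 0) :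
    a = 0 := by
  refine LinearMap.pi_ext fun i c => ?_
  suffices h0 : a (Pi.single i 1) = 0 by
    have : Pi.single i c = c • (Pi.single i 1 : Fin n → MonoidAlgebra k G) := by
      rw [← Pi.single_smul]; simp
    rw [this, map_smul, h0]; simp
  refine (Module.forall_dual_apply_eq_zero_iff k _).1 fun χ => ?_
  have := h (LinearMap.single _ _ i ∘ₗ ofLinearForm χ)
  rw [traceForm, Finset.sum_eq_single i] at this
  · simpa [coeffOne_ofLinearForm] using this
  · intro j _ hj
    simp [hj]
  · simp

/-- A linear form on the endomorphisms of `X` that vanishes on the maps through free modules gives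
a homomorphism from `X` to its syzygy, whose composite with `h : Y → X` factors through a free
module whenever the form vanishes on the endomorphisms that factor through `h`. -/
theorem exists_almostVanishing {n m : ℕ}
    {π : (Fin n → MonoidAlgebra k G) →ₗ[MonoidAlgebra k G] X} (hπ : Function.Surjective π)
    {ρ : (Fin m → MonoidAlgebra k G) →ₗ[MonoidAlgebra k G] LinearMap.ker π}
    (hρ : Function.Surjective ρ) (χ : (X →ₗ[MonoidAlgebra k G] X) →ₗ[k] k)
    (hχ_id : χ LinearMap.id ≠ 0)
    (hχ : ∀ u : X →ₗ[MonoidAlgebra k G] (Fin n → MonoidAlgebra k G), χ (π ∘ₗ u) = 0) :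
    ∃ ψ : X →ₗ[MonoidAlgebra k G] LinearMap.ker π,
      (¬ ∃ ζ : X →ₗ[MonoidAlgebra k G] (Fin m → MonoidAlgebra k G), ρ ∘ₗ ζ = ψ) ∧
      ∀ {Y : Type*} [AddCommGroup Y] [Module k Y] [Module (MonoidAlgebra k G) Y]
        [IsScalarTower k (MonoidAlgebra k G) Y] (h : Y →ₗ[MonoidAlgebra k G] X),
        (∀ y : X →ₗ[MonoidAlgebra k G] Y, χ (h ∘ₗ y) = 0) →
          ∃ ζ : Y →ₗ[MonoidAlgebra k G] (Fin m → MonoidAlgebra k G), ρ ∘ₗ ζ = ψ ∘ₗ h := by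
  let res : (X →ₗ[MonoidAlgebra k G] X) →ₗ[k]
      ((Fin n → MonoidAlgebra k G) →ₗ[MonoidAlgebra k G] X) :=
    { toFun := fun y => y ∘ₗ π
      map_add' := fun _ _ => rfl
      map_smul' := fun _ _ => rfl }
  have hres : Function.Injective res := fun y z h => (LinearMap.cancel_right hπ).1 h
  -- Extend `χ` from End(X), embedded by composition with `π`, to all maps from the free cover,
  -- where trace duality applies.
  obtain ⟨r, hr⟩ := LinearMap.exists_leftInverse_of_injective res (LinearMap.ker_eq_bot.2 hres)
  obtain ⟨ψ₀, hψ₀⟩ := exists_eq_traceForm (χ ∘ₗ r)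
  have key (y : X →ₗ[MonoidAlgebra k G] X) : χ y = traceForm (ψ₀ ∘ₗ y ∘ₗ π) := by
    have := hψ₀ (res y)
    rwa [LinearMap.comp_apply, show r (res y) = y from LinearMap.congr_fun hr y] at this
  -- The vanishing of `χ` on maps through the cover is, by cyclicity of the trace, what makes `ψ₀`
  -- land in the syzygy.
  have hker : π ∘ₗ ψ₀ = 0 := by
    have : π ∘ₗ ψ₀ ∘ₗ π = 0 := by
      refine eq_zero_of_traceForm_comp fun u => ?_
      rw [← hχ u, key]
      exact traceForm_comp_comm (ψ₀ ∘ₗ π) (u ∘ₗ π)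
    exact (LinearMap.cancel_right hπ).1 (by rw [LinearMap.comp_assoc, this, LinearMap.zero_comp])
  let ψ : X →ₗ[MonoidAlgebra k G] LinearMap.ker π :=
    ψ₀.codRestrict _ fun x => LinearMap.congr_fun hker x
  have hψ : (LinearMap.ker π).subtype ∘ₗ ψ = ψ₀ := rfl
  refine ⟨ψ, ?_, ?_⟩
  · rintro ⟨ζ, hζ⟩
    refine hχ_id ?_
    rw [key, ← hψ, ← hζ]
    refine (traceForm_comp_comm (ζ ∘ₗ π) ((LinearMap.ker π).subtype ∘ₗ ρ)).trans ?_
    have : (ζ ∘ₗ π) ∘ₗ ((LinearMap.ker π).subtype ∘ₗ ρ) = 0 := by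
      refine LinearMap.ext fun x => ?_
      simp
    rw [this]
    simp [traceForm]
  · intro Y _ _ _ _ h hh
    let res' : ((Fin n → MonoidAlgebra k G) →ₗ[MonoidAlgebra k G] Y) →ₗ[k]
        ((Fin m → MonoidAlgebra k G) →ₗ[MonoidAlgebra k G] Y) :=
      { toFun := fun y => y ∘ₗ (LinearMap.ker π).subtype ∘ₗ ρ
        map_add' := fun _ _ => rfl
        map_smul' := fun _ _ => rfl }
    let τ : ((Fin n → MonoidAlgebra k G) →ₗ[MonoidAlgebra k G] Y) →ₗ[k] k :=
      { toFun := fun a => traceForm (ψ₀ ∘ₗ h ∘ₗ a)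
        map_add' := by intro a b; simp [traceForm, Finset.sum_add_distrib]
        map_smul' := by
          intro c a
          simp [traceForm, Finset.mul_sum] }
    -- A map killed by `res'` vanishes on the kernel of `π`, hence is `y ∘ₗ π`, and `τ` takes it to
    -- `χ (h ∘ₗ y) = 0`. So `τ` factors through `res'`, and the representing map of the factor is
    -- the required lift.
    have hτ : LinearMap.ker res' ≤ LinearMap.ker τ := by
      intro a ha
      have ha' : a ∘ₗ (LinearMap.ker π).subtype = 0 :=
        (LinearMap.cancel_right hρ).1 (by rw [LinearMap.comp_assoc]; exact ha)
      obtain ⟨y, hy⟩ : ∃ y : X →ₗ[MonoidAlgebra k G] Y, y ∘ₗ π = a := by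
        have hle : LinearMap.ker π ≤ LinearMap.ker a := fun x hx =>
          LinearMap.congr_fun ha' ⟨x, hx⟩
        refine ⟨(LinearMap.ker π).liftQ a hle ∘ₗ (π.quotKerEquivOfSurjective hπ).symm, ?_⟩
        refine LinearMap.ext fun x => ?_
        have : (π.quotKerEquivOfSurjective hπ).symm (π x) = (LinearMap.ker π).mkQ x := by
          rw [LinearEquiv.symm_apply_eq]; rfl
        simp [this]
      have := hh y
      rw [key] at this
      change traceForm (ψ₀ ∘ₗ h ∘ₗ a) = 0
      rwa [← hy]
    obtain ⟨σ, hσ⟩ : ∃ σ, σ ∘ₗ res' = τ := by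
      have : τ ∈ LinearMap.range res'.dualMap := by
        rw [LinearMap.range_dualMap_eq_dualAnnihilator_ker]
        exact (Submodule.mem_dualAnnihilator _).2 fun a ha => hτ ha
      exact this
    obtain ⟨ζ, hζ⟩ := exists_eq_traceForm σ
    refine ⟨ζ, ?_⟩
    have : ((LinearMap.ker π).subtype ∘ₗ ρ) ∘ₗ ζ = ψ₀ ∘ₗ h := by
      refine eq_of_traceForm_comp_eq fun a => ?_
      refine Eq.trans ?_ (LinearMap.congr_fun hσ a)
      rw [LinearMap.comp_apply, hζ]
      exact traceForm_comp_comm (ζ ∘ₗ a) ((LinearMap.ker π).subtype ∘ₗ ρ)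
    ext1 y
    exact Subtype.ext (LinearMap.congr_fun this y)

end Trace

/-! ### Short exact sequences and stable endomorphisms -/

section Ring

variable {R : Type u} [Ring R] {A B C A' B' C' M N P Q : FGModuleCat.{u} R}

instance : (toSt R).Additive := Quotient.functor_additive (stableRel R) stableRel_add

theorem toSt_map_eq_zero_iff {f : M ⟶ N} : (toSt R).map f = 0 ↔
    ∃ (P : FGModuleCat.{u} R) (a : M ⟶ P) (b : P ⟶ N), Module.Projective R P ∧ f = a ≫ b := by
  rw [← (toSt R).map_zero, Quotient.functor_map_eq_iff]
  simp [stableRel]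

theorem toSt_map_comp_eq_zero (hP : Module.Projective R P) (a : M ⟶ P) (b : P ⟶ N) :
    (toSt R).map (a ≫ b) = 0 :=
  toSt_map_eq_zero_iff.2 ⟨P, a, b, hP, rfl⟩

theorem toSt_map_id_eq_zero_iff : (toSt R).map (𝟙 M) = 0 ↔ Module.Projective R M := by
  rw [toSt_map_eq_zero_iff]
  constructor
  · rintro ⟨P, a, b, hP, h⟩
    exact Module.Projective.of_split a.hom.hom b.hom.hom (by
      rw [← FGModuleCat.hom_hom_comp, ← h]; rfl)
  · intro hM
    exact ⟨M, 𝟙 M, 𝟙 M, hM, by simp⟩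

theorem exists_lift_of_projective (hP : Module.Projective R P) {g : B ⟶ C}
    (hg : Function.Surjective g.hom.hom) (u : P ⟶ C) : ∃ v : P ⟶ B, v ≫ g = u := by
  obtain ⟨v, hv⟩ := Module.projective_lifting_property g.hom.hom u.hom.hom hg
  exact ⟨FGModuleCat.ofHom v, FGModuleCat.hom_ext hv⟩

namespace IsShortExact

theorem comp_eq_zero {f : A ⟶ B} {g : B ⟶ C} (h : IsShortExact f g) : f ≫ g = 0 := by
  ext x
  exact h.exact.apply_apply_eq_zero x

theorem exists_desc {f : A ⟶ B} {g : B ⟶ C} (h : IsShortExact f g) (u : B ⟶ M)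
    (hu : f ≫ u = 0) : ∃ v : C ⟶ M, g ≫ v = u := by
  have hle : LinearMap.ker g.hom.hom ≤ LinearMap.ker u.hom.hom := by
    intro x hx
    obtain ⟨y, rfl⟩ := (h.exact x).1 hx
    exact LinearMap.congr_fun (congrArg (fun w => w.hom.hom) hu) y
  refine ⟨FGModuleCat.ofHom ((LinearMap.ker g.hom.hom).liftQ u.hom.hom hle ∘ₗ
    (g.hom.hom.quotKerEquivOfSurjective h.surjective).symm), ?_⟩
  ext x
  have : (g.hom.hom.quotKerEquivOfSurjective h.surjective).symm (g.hom.hom x) =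
      (LinearMap.ker g.hom.hom).mkQ x := by
    rw [LinearEquiv.symm_apply_eq]; rfl
  change (LinearMap.ker g.hom.hom).liftQ u.hom.hom hle
    ((g.hom.hom.quotKerEquivOfSurjective h.surjective).symm (g.hom.hom x)) = _
  rw [this]
  rfl

theorem exists_codesc {f : A ⟶ B} {g : B ⟶ C} (h : IsShortExact f g) (u : M ⟶ B)
    (hu : u ≫ g = 0) : ∃ v : M ⟶ A, v ≫ f = u := by
  have hmem (x : M) : u.hom.hom x ∈ LinearMap.range f.hom.hom :=
    (h.exact _).1 (LinearMap.congr_fun (congrArg (fun w => w.hom.hom) hu) x)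
  refine ⟨FGModuleCat.ofHom ((LinearEquiv.ofInjective f.hom.hom h.injective).symm.toLinearMap ∘ₗ
    u.hom.hom.codRestrict _ hmem), ?_⟩
  ext x
  exact congrArg Subtype.val
    ((LinearEquiv.ofInjective f.hom.hom h.injective).apply_symm_apply ⟨u.hom.hom x, hmem x⟩)

theorem cancel_mono {f : A ⟶ B} {g : B ⟶ C} (h : IsShortExact f g) {u v : M ⟶ A}
    (huv : u ≫ f = v ≫ f) : u = v := by
  ext x
  exact h.injective (LinearMap.congr_fun (congrArg (fun w => w.hom.hom) huv) x)

theorem cancel_epi {f : A ⟶ B} {g : B ⟶ C} (h : IsShortExact f g) {u v : C ⟶ M}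
    (huv : g ≫ u = g ≫ v) : u = v := by
  ext x
  obtain ⟨y, rfl⟩ := h.surjective x
  exact LinearMap.congr_fun (congrArg (fun w => w.hom.hom) huv) y

/-- A short exact sequence with a retraction of the first map splits. -/
theorem exists_section {f : A ⟶ B} {g : B ⟶ C} (h : IsShortExact f g) {r : B ⟶ A}
    (hr : f ≫ r = 𝟙 A) : ∃ s : C ⟶ B, s ≫ g = 𝟙 C := by
  obtain ⟨s, hs⟩ := h.exists_desc (𝟙 B - r ≫ f) (by
    rw [Preadditive.comp_sub, ← Category.assoc, hr]; simp)
  refine ⟨s, h.cancel_epi ?_⟩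
  rw [← Category.assoc, hs, Preadditive.sub_comp, Category.assoc, h.comp_eq_zero]
  simp

/-- In a map of short exact sequences whose last component is stably zero, the first component
extends to the middle term of the first sequence. -/
theorem exists_extension_of_map_eq_zero {f : A ⟶ B} {g : B ⟶ C} {f' : A' ⟶ B'} {g' : B' ⟶ C'}
    (h : IsShortExact f g) (h' : IsShortExact f' g') {α : A ⟶ A'} {β : B ⟶ B'} {γ : C ⟶ C'}
    (hα : f ≫ β = α ≫ f') (hγ : g ≫ γ = β ≫ g') (h0 : (toSt R).map γ = 0) :
    ∃ t : B ⟶ A', f ≫ t = α := by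
  -- Lift the second factor of `γ` to `B'` and subtract the resulting map from `β`: the difference
  -- lands in `A'` and restricts to `α`.
  obtain ⟨Q, a, b, hQ, e⟩ := toSt_map_eq_zero_iff.1 h0
  obtain ⟨b', hb'⟩ := exists_lift_of_projective hQ h'.surjective b
  obtain ⟨t, ht⟩ := h'.exists_codesc (β - g ≫ a ≫ b') (by
    rw [Preadditive.sub_comp, ← hγ, e]; simp [hb'])
  refine ⟨t, h'.cancel_mono ?_⟩
  rw [Category.assoc, ht, Preadditive.comp_sub, hα, ← Category.assoc f, h.comp_eq_zero]
  simp

end IsShortExact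

theorem isShortExact_syzygy [IsNoetherianRing R] (M : FGModuleCat.{u} R) :
    IsShortExact (syzygyι M) (coverπ M) where
  injective := Subtype.val_injective
  exact := LinearMap.exact_subtype_ker_map (coverMap M)
  surjective := coverMap_surjective M

theorem projective_cover (M : FGModuleCat.{u} R) : Module.Projective R (cover M) :=
  inferInstanceAs (Module.Projective R (Fin (coverRank M) → R))

/-- Every endomorphism is stably invertible or stably nilpotent. -/
def IsStablyLocal (M : FGModuleCat.{u} R) : Prop :=
  ∀ c : End M, IsIso ((toSt R).map c) ∨ ∃ n : ℕ, (toSt R).map (c ^ n) = 0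

theorem end_pow_hom_hom (c : End M) (n : ℕ) :
    (c ^ n : End M).hom.hom = (c.hom.hom : Module.End R M) ^ n := by
  induction n with
  | zero => rfl
  | succ n ih =>
    rw [pow_succ, pow_succ, ← ih]
    rfl

theorem IsIndecomposable.isStablyLocal [IsArtinianRing R] [IsNoetherianRing R]
    (hM : IsIndecomposable M) : IsStablyLocal M := by
  intro c
  rcases bijective_or_isNilpotent hM.2 c.hom.hom with h | ⟨n, hn⟩
  · left
    have : IsIso (show M ⟶ M from c) := by
      let e := LinearEquiv.ofBijective c.hom.hom h
      refine ⟨FGModuleCat.ofHom e.symm.toLinearMap, ?_, ?_⟩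
      · ext x; exact e.symm_apply_apply x
      · ext x; exact e.apply_symm_apply x
    exact inferInstanceAs (IsIso ((toSt R).map (show M ⟶ M from c)))
  · right
    refine ⟨n, ?_⟩
    have : c ^ n = 0 := FGModuleCat.hom_ext ((end_pow_hom_hom c n).trans hn)
    rw [this]
    exact (toSt R).map_zero _ _

/-- Transport of the property along a correspondence of endomorphisms that induces an isomorphism
of stable endomorphism rings. -/
theorem IsStablyLocal.of_rel {S : End M → End N → Prop} (left : ∀ c, ∃ d, S c d)
    (right : ∀ d, ∃ c, S c d) (one : S 1 1)
    (mul : ∀ {c d c' d'}, S c d → S c' d' → S (c * c') (d * d'))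
    (sub : ∀ {c d c' d'}, S c d → S c' d' → S (c - c') (d - d'))
    (zero : ∀ {c d}, S c d → (toSt R).map d = 0 → (toSt R).map c = 0) (hN : IsStablyLocal N) :
    IsStablyLocal M := by
  intro c
  obtain ⟨d, hd⟩ := left c
  rcases hN d with h | ⟨n, hn⟩
  -- Any `c'` related to a representative `d'` of the stable inverse will do: the defects of `c'` as
  -- an inverse of `c` are related to stably zero maps.
  · left
    obtain ⟨d', hd'⟩ := (toSt R).map_surjective (inv ((toSt R).map d))
    obtain ⟨c', hc'⟩ := right d'
    refine ⟨(toSt R).map c', ?_, ?_⟩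
    · have := zero (sub (mul hc' hd) one) (by
        change (toSt R).map (d ≫ d' - 𝟙 _) = 0
        rw [Functor.map_sub, Functor.map_comp, hd']; simp)
      change (toSt R).map (c ≫ c' - 𝟙 _) = 0 at this
      rwa [Functor.map_sub, Functor.map_comp, sub_eq_zero, CategoryTheory.Functor.map_id] at this
    · have := zero (sub (mul hd hc') one) (by
        change (toSt R).map (d' ≫ d - 𝟙 _) = 0
        rw [Functor.map_sub, Functor.map_comp, hd']; simp)
      change (toSt R).map (c' ≫ c - 𝟙 _) = 0 at this
      rwa [Functor.map_sub, Functor.map_comp, sub_eq_zero, CategoryTheory.Functor.map_id] at this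
  · right
    have hpow (n : ℕ) : S (c ^ n) (d ^ n) := by
      induction n with
      | zero => simpa using one
      | succ n ih => rw [pow_succ, pow_succ]; exact mul ih hd
    exact ⟨n, zero (hpow n) hn⟩

end Ring

/-! ### Projectives as injectives, stable locality under Ω, right almost split maps -/

section GroupAlgebra

variable {k G : Type u} [Field k] [Group G]

/-- The underlying vector space of a module over the group algebra. -/
abbrev vectorSpace (M : FGModuleCat.{u} (MonoidAlgebra k G)) : Module k M :=
  Module.compHom M (algebraMap k (MonoidAlgebra k G))

theorem isScalarTower_vectorSpace (M : FGModuleCat.{u} (MonoidAlgebra k G)) :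
    letI := vectorSpace M
    IsScalarTower k (MonoidAlgebra k G) M :=
  letI := vectorSpace M
  IsScalarTower.of_algebraMap_smul fun _ _ => rfl

variable (k G) in
theorem isIndecomposable_trivialModule : IsIndecomposable (trivialModule k G) := by
  constructor
  · exact inferInstanceAs (Nontrivial k)
  · intro U V h
    by_cases hU : U = ⊥
    · exact Or.inl hU
    · right
      obtain ⟨x, hx, hx0⟩ := U.exists_mem_ne_zero_of_ne_bot hU
      have hU' : U = ⊤ := by
        refine eq_top_iff.2 fun y _ => ?_
        let x' : k := x
        let y' : k := y
        have hxk : x' ≠ 0 := hx0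
        have : y = (algebraMap k (MonoidAlgebra k G) (y' / x')) • x := by
          change y' = (Representation.asAlgebraHom (Representation.trivial k G k)
            (algebraMap k (MonoidAlgebra k G) (y' / x'))) x'
          rw [AlgHom.commutes]
          simp [hxk]
        rw [this]
        exact U.smul_mem _ hx
      rw [hU'] at h
      simpa using h.inf_eq_bot

variable [Finite G] {A B C A' B' C' M N P : FGModuleCat.{u} (MonoidAlgebra k G)}

instance : IsArtinianRing (MonoidAlgebra k G) :=
  have : Module.Finite k (MonoidAlgebra k G) := inferInstance
  IsArtinianRing.of_finite k (MonoidAlgebra k G)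

theorem exists_extension_of_projective (hP : Module.Projective (MonoidAlgebra k G) P) {f : A ⟶ B}
    (hf : Function.Injective f.hom.hom) (u : A ⟶ P) : ∃ v : B ⟶ P, f ≫ v = u := by
  let _ := vectorSpace A
  let _ := vectorSpace B
  have := isScalarTower_vectorSpace A
  have := isScalarTower_vectorSpace B
  obtain ⟨n, r, s, -, -, hrs⟩ := Module.Finite.exists_comp_eq_id_of_projective (MonoidAlgebra k G) P
  obtain ⟨v, hv⟩ := exists_extension f.hom.hom hf (s ∘ₗ u.hom.hom)
  refine ⟨FGModuleCat.ofHom (r ∘ₗ v), ?_⟩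
  ext x
  have h1 : v (f.hom.hom x) = s (u.hom.hom x) := LinearMap.congr_fun hv x
  have h2 := LinearMap.congr_fun hrs (u.hom.hom x)
  change r (v (f.hom.hom x)) = _
  rw [h1]
  exact h2

theorem exists_map_shortExact {f : A ⟶ B} {g : B ⟶ C} {f' : A' ⟶ P} {g' : P ⟶ C'}
    (h : IsShortExact f g) (h' : IsShortExact f' g') (hP : Module.Projective (MonoidAlgebra k G) P)
    (α : A ⟶ A') : ∃ (β : B ⟶ P) (γ : C ⟶ C'), f ≫ β = α ≫ f' ∧ g ≫ γ = β ≫ g' := by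
  obtain ⟨β, hβ⟩ := exists_extension_of_projective hP h.injective (α ≫ f')
  obtain ⟨γ, hγ⟩ := h.exists_desc (β ≫ g') (by
    rw [← Category.assoc, hβ, Category.assoc, h'.comp_eq_zero]; simp)
  exact ⟨β, γ, hβ, hγ⟩

/-- The outer terms of a short exact sequence with projective middle term have the same stable
endomorphism ring. -/
theorem isStablyLocal_iff {f : A ⟶ P} {g : P ⟶ C} (h : IsShortExact f g)
    (hP : Module.Projective (MonoidAlgebra k G) P) : IsStablyLocal A ↔ IsStablyLocal C := by
  let S : End A → End C → Prop := fun α γ =>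
    ∃ β : P ⟶ P, f ≫ β = (show A ⟶ A from α) ≫ f ∧ g ≫ (show C ⟶ C from γ) = β ≫ g
  have left (α : End A) : ∃ γ, S α γ := by
    obtain ⟨β, γ, h1, h2⟩ := exists_map_shortExact h h hP α
    exact ⟨γ, β, h1, h2⟩
  have right (γ : End C) : ∃ α, S α γ := by
    obtain ⟨β, hβ⟩ := exists_lift_of_projective hP h.surjective (g ≫ γ)
    obtain ⟨α, hα⟩ := h.exists_codesc (f ≫ β) (by
      rw [Category.assoc, hβ, ← Category.assoc, h.comp_eq_zero]; simp)
    exact ⟨α, β, hα.symm, hβ.symm⟩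
  have one : S 1 1 := ⟨𝟙 P, by
    change f ≫ 𝟙 P = 𝟙 A ≫ f; simp, by change g ≫ 𝟙 C = 𝟙 P ≫ g; simp⟩
  have mul {c d c' d'} : S c d → S c' d' → S (c * c') (d * d') := by
    rintro ⟨b, h1, h2⟩ ⟨b', h1', h2'⟩
    refine ⟨b' ≫ b, ?_, ?_⟩
    · change f ≫ b' ≫ b = (c' ≫ c) ≫ f
      rw [← Category.assoc, h1', Category.assoc, h1, Category.assoc]
    · change g ≫ d' ≫ d = _
      rw [← Category.assoc, h2', Category.assoc, h2, Category.assoc]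
  have sub {c d c' d'} : S c d → S c' d' → S (c - c') (d - d') := by
    rintro ⟨b, h1, h2⟩ ⟨b', h1', h2'⟩
    refine ⟨b - b', ?_, ?_⟩
    · rw [Preadditive.comp_sub, h1, h1']
      exact (Preadditive.sub_comp _ _ _).symm
    · rw [Preadditive.sub_comp, ← h2, ← h2']
      exact Preadditive.comp_sub _ _ _
  constructor
  · refine IsStablyLocal.of_rel (S := fun γ α => S α γ) right left one mul sub ?_
    rintro γ α ⟨β, h1, h2⟩ h0
    -- Dual to `exists_extension_of_map_eq_zero`: the first factor of `α` extends to `P` because `Q`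
    -- is injective relative to `f`, and the corrected `β` descends to `C`.
    obtain ⟨Q, a, b, hQ, e⟩ := toSt_map_eq_zero_iff.1 h0
    obtain ⟨a', ha'⟩ := exists_extension_of_projective hQ h.injective a
    obtain ⟨t, ht⟩ := h.exists_desc (β - a' ≫ b ≫ f) (by
      rw [Preadditive.comp_sub, h1, ← Category.assoc f, ha', ← Category.assoc a, ← e]
      exact sub_self _)
    have : (show C ⟶ C from γ) = t ≫ g := h.cancel_epi (by
      rw [h2, ← Category.assoc, ht, Preadditive.sub_comp]
      simp [h.comp_eq_zero])
    exact (congrArg _ this).trans (toSt_map_comp_eq_zero hP t g)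
  · refine IsStablyLocal.of_rel (S := S) left right one mul sub ?_
    rintro α γ ⟨β, h1, h2⟩ h0
    obtain ⟨t, rfl⟩ := h.exists_extension_of_map_eq_zero h h1 h2 h0
    exact toSt_map_comp_eq_zero hP f t

theorem isShortExact_cosyzygy (M : FGModuleCat.{u} (MonoidAlgebra k G)) :
    IsShortExact (hullι M) (cosyzygyπ M) where
  injective := hullMap_injective M
  exact := LinearMap.exact_map_mkQ_range (hullMap M)
  surjective := Submodule.mkQ_surjective _

theorem projective_hull (M : FGModuleCat.{u} (MonoidAlgebra k G)) :
    Module.Projective (MonoidAlgebra k G) (hull M) :=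
  inferInstanceAs (Module.Projective (MonoidAlgebra k G) (Fin (hullRank M) → MonoidAlgebra k G))

theorem IsStablyLocal.omega (hM : IsStablyLocal M) : ∀ i : ℤ, IsStablyLocal (omega i M)
  | Int.ofNat n => by
    change IsStablyLocal (syzygy^[n] M)
    induction n with
    | zero => exact hM
    | succ n ih =>
      rw [Function.iterate_succ_apply']
      exact (isStablyLocal_iff (isShortExact_syzygy _) (projective_cover _)).2 ih
  | Int.negSucc n => by
    change IsStablyLocal (cosyzygy^[n + 1] M)
    induction n + 1 with
    | zero => exact hM
    | succ n ih =>
      rw [Function.iterate_succ_apply']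
      exact (isStablyLocal_iff (isShortExact_cosyzygy _) (projective_hull _)).1 ih

/-- The second map of a short exact sequence is right almost split. -/
def IsRightAlmostSplit (g : B ⟶ C) : Prop :=
  Function.Surjective g.hom.hom ∧ (¬ ∃ s : C ⟶ B, s ≫ g = 𝟙 C) ∧
    ∀ (M : FGModuleCat.{u} (MonoidAlgebra k G)) (h : M ⟶ C),
      (¬ ∃ s : C ⟶ M, s ≫ h = 𝟙 C) → ∃ h' : M ⟶ B, h' ≫ g = h

/-- A linear form on the endomorphisms of an indecomposable module that vanishes on the maximal
ideal. -/
theorem exists_linearForm_end (k : Type*) {Λ X : Type*} [Field k] [Ring Λ] [Algebra k Λ]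
    [AddCommGroup X] [Module k X] [Module Λ X] [IsScalarTower k Λ X] [IsNoetherian Λ X]
    [IsArtinian Λ X] [Nontrivial X] (hX : ∀ U V : Submodule Λ X, IsCompl U V → U = ⊥ ∨ V = ⊥) :
    ∃ χ : (X →ₗ[Λ] X) →ₗ[k] k, χ LinearMap.id ≠ 0 ∧
      ∀ f : X →ₗ[Λ] X, ¬ Function.Bijective f → χ f = 0 := by
  let J : Submodule k (X →ₗ[Λ] X) :=
    { carrier := {f | ¬ Function.Bijective f}
      add_mem' := not_bijective_add hX
      zero_mem' := fun h => by
        obtain ⟨x, hx⟩ := exists_ne (0 : X)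
        exact hx (h.1 rfl)
      smul_mem' := by
        intro c f hf hcf
        by_cases hc : c = 0
        · subst hc
          obtain ⟨x, hx⟩ := exists_ne (0 : X)
          exact hx (hcf.1 (by simp))
        · refine hf ⟨fun x y hxy => hcf.1 (by simp [hxy]), fun y => ?_⟩
          obtain ⟨x, hx⟩ := hcf.2 (c • y)
          exact ⟨x, smul_right_injective X hc hx⟩ }
  have h1 : LinearMap.id ∉ J := fun h => h Function.bijective_id
  obtain ⟨χ, hχ, hJ⟩ := Submodule.exists_le_ker_of_notMem h1
  exact ⟨χ, hχ, fun f hf => hJ hf⟩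

/-- The sequence is the pullback of the cover of ΩN along the almost vanishing map `ψ`: lifting a
map to it is the same as factoring the composite with `ψ` through the cover. -/
theorem exists_isRightAlmostSplit (hN : IsIndecomposable N)
    (hP : ¬ Module.Projective (MonoidAlgebra k G) N) :
    ∃ (B : FGModuleCat.{u} (MonoidAlgebra k G)) (f : omega 2 N ⟶ B) (g : B ⟶ N),
      IsShortExact f g ∧ IsRightAlmostSplit g := by
  let _ := vectorSpace N
  have := isScalarTower_vectorSpace N
  have := hN.1
  obtain ⟨χ, hχ_id, hχ⟩ := exists_linearForm_end k hN.2
  let ρ : (Fin (coverRank (syzygy N)) → MonoidAlgebra k G) →ₗ[MonoidAlgebra k G]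
    LinearMap.ker (coverMap N) := coverMap (syzygy N)
  -- An automorphism of `N` through the free cover would make `N` projective, so the form kills all
  -- endomorphisms through it.
  obtain ⟨ψ, hψ, hψ'⟩ := exists_almostVanishing (coverMap_surjective N) (ρ := ρ)
    (coverMap_surjective (syzygy N)) χ hχ_id (fun u => hχ _ fun hb => hP (by
      let e := LinearEquiv.ofBijective _ hb
      refine Module.Projective.of_split u (e.symm.toLinearMap ∘ₗ coverMap N) ?_
      exact LinearMap.ext fun x => e.symm_apply_apply x))
  let E : Submodule (MonoidAlgebra k G) (N × (Fin (coverRank (syzygy N)) → MonoidAlgebra k G)) :=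
    LinearMap.eqLocus (ψ ∘ₗ LinearMap.fst _ _ _) (ρ ∘ₗ LinearMap.snd _ _ _)
  let f : LinearMap.ker ρ →ₗ[MonoidAlgebra k G] E :=
    (LinearMap.inr _ _ _ ∘ₗ (LinearMap.ker ρ).subtype).codRestrict E fun z => by
      change ψ 0 = ρ z
      rw [map_zero, z.2]
  let g : E →ₗ[MonoidAlgebra k G] N := LinearMap.fst _ _ _ ∘ₗ E.subtype
  have hg : Function.Surjective g := by
    intro n
    obtain ⟨q, hq⟩ := coverMap_surjective (syzygy N) (ψ n)
    exact ⟨⟨(n, q), hq.symm⟩, rfl⟩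
  have hE (x : E) : ψ x.1.1 = ρ x.1.2 := x.2
  refine ⟨FGModuleCat.of _ E, FGModuleCat.ofHom f, FGModuleCat.ofHom g, ⟨?_, ?_, hg⟩, hg, ?_, ?_⟩
  · intro x y hxy
    exact Subtype.ext (congrArg (fun z : E => z.1.2) hxy)
  · intro x
    constructor
    · intro (hx : x.1.1 = 0)
      have := hE x
      rw [hx, map_zero] at this
      exact ⟨⟨x.1.2, this.symm⟩, Subtype.ext (Prod.ext hx.symm rfl)⟩
    · rintro ⟨y, rfl⟩
      rfl
  · rintro ⟨s, hs⟩
    refine hψ ⟨LinearMap.snd _ _ _ ∘ₗ E.subtype ∘ₗ s.hom.hom, LinearMap.ext fun x => ?_⟩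
    have h1 : (s.hom.hom x).1.1 = x := LinearMap.congr_fun (congrArg (fun w => w.hom.hom) hs) x
    have h2 := hE (s.hom.hom x)
    rw [h1] at h2
    exact h2.symm
  · intro M h hh
    let _ := vectorSpace M
    have := isScalarTower_vectorSpace M
    -- If `h ∘ y` were an automorphism, `h` would be a split epimorphism.
    obtain ⟨ζ, hζ⟩ := hψ' h.hom.hom fun y => hχ _ fun hb => hh (by
      let e := LinearEquiv.ofBijective _ hb
      refine ⟨FGModuleCat.ofHom (y ∘ₗ e.symm.toLinearMap), ?_⟩
      ext x
      exact e.apply_symm_apply x)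
    exact ⟨FGModuleCat.ofHom ((h.hom.hom.prod ζ).codRestrict E fun x =>
      (LinearMap.congr_fun hζ x).symm), rfl⟩

end GroupAlgebra

/-! ### Modular lattice and length arguments for shrinking kernels -/

section Split

variable {R M : Type*} [Ring R] [AddCommGroup M] [Module R M]

/-- If an element `L` has complements modulo `U` and modulo `V`, where `U ⊔ V = L`, then it
has a complement modulo `U ⊓ V`. -/
theorem exists_inf_eq_sup_eq_top {α : Type*} [Lattice α] [OrderTop α] [IsModularLattice α]
    {L U V : α} (hUV : U ⊔ V = L) (hU : ∃ W, W ⊓ L = U ∧ W ⊔ L = ⊤)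
    (hV : ∃ W, W ⊓ L = V ∧ W ⊔ L = ⊤) : ∃ W, W ⊓ L = U ⊓ V ∧ W ⊔ L = ⊤ := by
  obtain ⟨W₁, h₁, h₁'⟩ := hU
  obtain ⟨W₂, h₂, h₂'⟩ := hV
  refine ⟨W₁ ⊓ W₂, by rw [← h₁, ← h₂, ← inf_inf_distrib_right], ?_⟩
  have hUW : U ≤ W₁ := h₁ ▸ inf_le_left
  have hVW : V ≤ W₂ := h₂ ▸ inf_le_left
  have e : W₂ ⊔ U = ⊤ := by
    rw [← h₂', ← hUV, sup_comm U V, ← sup_assoc, sup_eq_left.2 hVW]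
  -- The modular law, applied with `U ≤ W₁` and `W₂ ⊔ U = ⊤`; since `U ≤ L`, joining with `L`
  -- absorbs `U`.
  have e' : W₁ = U ⊔ (W₁ ⊓ W₂) := by
    rw [inf_comm W₁, ← sup_inf_assoc_of_le W₂ hUW, sup_comm, e, top_inf_eq]
  have hUL : U ≤ L := hUV ▸ le_sup_left
  rw [← h₁']
  conv_rhs => rw [e', sup_comm U, sup_assoc, sup_eq_right.2 hUL]

theorem length_quotient_lt [IsNoetherian R M] [IsArtinian R M] {U : Submodule R M} (hU : U ≠ ⊥) :
    Module.length R (M ⧸ U) < Module.length R M := by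
  rw [Module.length_eq_add_of_exact U.subtype U.mkQ U.subtype_injective U.mkQ_surjective
    (LinearMap.exact_subtype_mkQ U)]
  have : Nontrivial U := U.nontrivial_iff_ne_bot.2 hU
  have h0 : 0 < Module.length R U := Module.length_pos
  have h1 : Module.length R (M ⧸ U) ≠ ⊤ := Module.length_ne_top
  exact ENat.lt_add_left h1 h0

end Split

/-! ### Existence of almost split sequences and comparison of their left-hand terms -/

section GroupAlgebra

variable {k G : Type u} [Field k] [Group G] {A B C E M N : FGModuleCat.{u} (MonoidAlgebra k G)}

theorem exists_section_of_isCompl {g : B ⟶ C} (hg : Function.Surjective g.hom.hom)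
    {W : Submodule (MonoidAlgebra k G) B} (h : W ⊓ LinearMap.ker g.hom.hom = ⊥)
    (h' : W ⊔ LinearMap.ker g.hom.hom = ⊤) : ∃ s : C ⟶ B, s ≫ g = 𝟙 C := by
  have hb : Function.Bijective (g.hom.hom ∘ₗ W.subtype) := by
    constructor
    · rw [injective_iff_map_eq_zero]
      intro x hx
      have : x.1 ∈ W ⊓ LinearMap.ker g.hom.hom := ⟨x.2, hx⟩
      rw [h] at this
      exact Subtype.ext this
    · intro c
      obtain ⟨b, rfl⟩ := hg c
      obtain ⟨w, hw, l, hl, rfl⟩ := Submodule.mem_sup.1 (h' ▸ Submodule.mem_top : b ∈ W ⊔ _)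
      refine ⟨⟨w, hw⟩, ?_⟩
      change g.hom.hom w = _
      rw [map_add, LinearMap.mem_ker.1 hl, add_zero]
  let e := LinearEquiv.ofBijective _ hb
  refine ⟨FGModuleCat.ofHom (W.subtype ∘ₗ e.symm.toLinearMap), ?_⟩
  ext x
  exact e.apply_symm_apply x

/-- Lifts to `B` pass to the quotient, so only a splitting can spoil the property there; the
preimage of the image of a section is then the required `W`. -/
theorem IsRightAlmostSplit.quotient_or {g : B ⟶ C} (hg : IsRightAlmostSplit g)
    {U : Submodule (MonoidAlgebra k G) B} (hU : U ≤ LinearMap.ker g.hom.hom) :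
    (∃ g' : FGModuleCat.of _ (B ⧸ U) ⟶ C, IsRightAlmostSplit g') ∨
      ∃ W, W ⊓ LinearMap.ker g.hom.hom = U ∧ W ⊔ LinearMap.ker g.hom.hom = ⊤ := by
  let g' : FGModuleCat.of (MonoidAlgebra k G) (B ⧸ U) ⟶ C :=
    FGModuleCat.ofHom (U.liftQ g.hom.hom hU)
  let q : B ⟶ FGModuleCat.of (MonoidAlgebra k G) (B ⧸ U) := FGModuleCat.ofHom U.mkQ
  have hq : q ≫ g' = g := rfl
  by_cases hs : ∃ s : C ⟶ _, s ≫ g' = 𝟙 C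
  · right
    obtain ⟨s, hs⟩ := hs
    have hs' (x : C) : g'.hom.hom (s.hom.hom x) = x :=
      LinearMap.congr_fun (congrArg (fun w => w.hom.hom) hs) x
    refine ⟨(LinearMap.range s.hom.hom).comap U.mkQ, le_antisymm ?_ ?_, eq_top_iff.2 ?_⟩
    · rintro x ⟨⟨y, hy⟩, hx⟩
      have h1 : g'.hom.hom (U.mkQ x) = 0 := hx
      rw [← hy, hs'] at h1
      rw [h1, map_zero] at hy
      exact (Submodule.Quotient.mk_eq_zero U).1 hy.symm
    · intro x hx
      refine ⟨⟨0, ?_⟩, hU hx⟩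
      rw [map_zero]
      exact ((Submodule.Quotient.mk_eq_zero U).2 hx).symm
    · intro x _
      obtain ⟨w, hw⟩ := U.mkQ_surjective (s.hom.hom (g.hom.hom x))
      refine Submodule.mem_sup.2 ⟨w, ⟨_, hw.symm⟩, x - w, ?_, by abel⟩
      have : g.hom.hom w = g'.hom.hom (U.mkQ w) := rfl
      rw [LinearMap.mem_ker, map_sub, this, hw, hs', sub_self]
  · left
    refine ⟨g', fun c => ?_, hs, fun M h hh => ?_⟩
    · obtain ⟨b, hb⟩ := hg.1 c
      exact ⟨U.mkQ b, hb⟩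
    · obtain ⟨h', rfl⟩ := hg.2.2 M h hh
      exact ⟨h' ≫ q, by rw [Category.assoc, hq]⟩

theorem isIso_of_isIso_comp {D : Type*} [Category D] {X Y : D} (x : X ⟶ Y) (y : Y ⟶ X)
    [IsIso (x ≫ y)] [IsIso (y ≫ x)] : IsIso x := by
  have h1 : x ≫ y ≫ inv (x ≫ y) = 𝟙 X := by rw [← Category.assoc, IsIso.hom_inv_id]
  have h2 : (inv (y ≫ x) ≫ y) ≫ x = 𝟙 Y := by rw [Category.assoc, IsIso.inv_hom_id]
  refine ⟨y ≫ inv (x ≫ y), h1, ?_⟩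
  have : inv (y ≫ x) ≫ y = y ≫ inv (x ≫ y) := by
    rw [← Category.comp_id (inv (y ≫ x) ≫ y), ← h1, ← Category.assoc, h2, Category.id_comp]
  rw [← this, h2]

/-- The idempotent `y ≫ x` is invertible or nilpotent. A nilpotent idempotent is zero, which would
make `A` stably zero, hence projective. -/
theorem isIso_of_comp_eq_id (hM : IsStablyLocal M) (hA : ¬ Module.Projective (MonoidAlgebra k G) A)
    {x : (toSt _).obj A ⟶ (toSt _).obj M} {y : (toSt _).obj M ⟶ (toSt _).obj A}
    (hxy : x ≫ y = 𝟙 _) : IsIso x := by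
  obtain ⟨c, hc⟩ := (toSt _).map_surjective (y ≫ x)
  rcases hM c with h | ⟨n, hn⟩
  · have h1 : IsIso (y ≫ x) := by rw [← hc]; exact h
    have h2 : IsIso (x ≫ y) := by rw [hxy]; infer_instance
    exact isIso_of_isIso_comp x y
  · exfalso
    have hidem : IsIdempotentElem (show End ((toSt (MonoidAlgebra k G)).obj M) from y ≫ x) := by
      change (y ≫ x) ≫ y ≫ x = y ≫ x
      rw [Category.assoc, ← Category.assoc x, hxy, Category.id_comp]
    have h0 : (show End ((toSt (MonoidAlgebra k G)).obj M) from y ≫ x) ^ n = 0 := by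
      rw [← hc]
      exact (map_pow ((toSt _).mapEnd M) (show End M from c) n).symm.trans hn
    have h1 : y ≫ x = 0 := by
      have := hidem.pow_succ_eq n
      rw [pow_succ, h0, zero_mul] at this
      exact this.symm
    apply hA
    have h2 : x ≫ (y ≫ x) ≫ y = 𝟙 _ := by
      rw [Category.assoc, ← Category.assoc x, hxy, Category.id_comp]
    rw [← toSt_map_id_eq_zero_iff, CategoryTheory.Functor.map_id, ← h2, h1]
    simp

variable [Finite G]

theorem isShortExact_ker {g : B ⟶ C} (hg : Function.Surjective g.hom.hom) :
    IsShortExact (A := FGModuleCat.of _ (LinearMap.ker g.hom.hom))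
      (FGModuleCat.ofHom (LinearMap.ker g.hom.hom).subtype) g where
  injective := Subtype.val_injective
  exact := LinearMap.exact_subtype_ker_map g.hom.hom
  surjective := hg

/-- If the kernel is U ⊕ V, dividing by U or by V keeps the map right almost split: were both
quotients split, intersecting the two relative complements would split `g` itself. -/
theorem IsRightAlmostSplit.exists_isAlmostSplit (hN : IsIndecomposable N) {g : B ⟶ N}
    (hg : IsRightAlmostSplit g) :
    ∃ (A B : FGModuleCat.{u} (MonoidAlgebra k G)) (f : A ⟶ B) (g : B ⟶ N), IsAlmostSplit f g := by
  induction hl : Module.length (MonoidAlgebra k G) B using WellFoundedLT.induction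
    generalizing B with
  | ind l ih =>
    subst hl
    by_cases hA : IsIndecomposable
      (FGModuleCat.of (MonoidAlgebra k G) (LinearMap.ker g.hom.hom))
    · exact ⟨_, B, _, g, isShortExact_ker hg.1, hA, hN, hg.2.1, hg.2.2⟩
    · have key {U : Submodule (MonoidAlgebra k G) (LinearMap.ker g.hom.hom)} (hU : U ≠ ⊥)
          (hW : ¬ ∃ W, W ⊓ LinearMap.ker g.hom.hom = U.map (LinearMap.ker g.hom.hom).subtype ∧
            W ⊔ LinearMap.ker g.hom.hom = ⊤) : ∃ (A B : FGModuleCat.{u} (MonoidAlgebra k G))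
            (f : A ⟶ B) (g : B ⟶ N), IsAlmostSplit f g := by
        obtain ⟨g', hg'⟩ := (hg.quotient_or (Submodule.map_subtype_le _ U)).resolve_right hW
        exact ih _ (length_quotient_lt fun hbot => hU (Submodule.map_injective_of_injective
          (Submodule.subtype_injective _) (by rw [hbot, Submodule.map_bot]))) hg' rfl
      by_cases hnt : Nontrivial (LinearMap.ker g.hom.hom)
      · have : ∃ U V : Submodule (MonoidAlgebra k G) (LinearMap.ker g.hom.hom),
            IsCompl U V ∧ U ≠ ⊥ ∧ V ≠ ⊥ := by
          by_contra! hcon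
          exact hA ⟨hnt, fun U V h => or_iff_not_imp_left.2 (hcon U V h)⟩
        obtain ⟨U, V, hUV, hU, hV⟩ := this
        by_cases h1 : ∃ W, W ⊓ LinearMap.ker g.hom.hom =
            U.map (LinearMap.ker g.hom.hom).subtype ∧ W ⊔ LinearMap.ker g.hom.hom = ⊤
        · by_cases h2 : ∃ W, W ⊓ LinearMap.ker g.hom.hom =
              V.map (LinearMap.ker g.hom.hom).subtype ∧ W ⊔ LinearMap.ker g.hom.hom = ⊤
          · obtain ⟨W, hW, hW'⟩ := exists_inf_eq_sup_eq_top (by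
              rw [← Submodule.map_sup, hUV.sup_eq_top, Submodule.map_subtype_top]) h1 h2
            rw [← Submodule.map_inf _ (Submodule.subtype_injective _), hUV.inf_eq_bot,
              Submodule.map_bot] at hW
            exact absurd (exists_section_of_isCompl hg.1 hW hW') hg.2.1
          · exact key hV h2
        · exact key hU h1
      · have h0 : LinearMap.ker g.hom.hom = ⊥ := by
          rwa [Submodule.nontrivial_iff_ne_bot, not_not] at hnt
        exact absurd (exists_section_of_isCompl hg.1 (W := ⊤) (by rw [h0, inf_bot_eq])
          (by rw [top_sup_eq])) hg.2.1

/-- A short exact sequence that does not split has no stable retraction of its first map. -/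
theorem not_exists_retraction {f : A ⟶ B} {g : B ⟶ C} (h : IsShortExact f g)
    (hs : ¬ ∃ s : C ⟶ B, s ≫ g = 𝟙 C) {r : B ⟶ A}
    (hr : (toSt _).map (f ≫ r) = 𝟙 _) : False := by
  rw [← CategoryTheory.Functor.map_id, ← sub_eq_zero, ← Functor.map_sub] at hr
  obtain ⟨P, a, b, hP, e⟩ := toSt_map_eq_zero_iff.1 hr
  -- The error term extends to `B`, so a stable retraction can be corrected to an honest one.
  obtain ⟨c, rfl⟩ := exists_extension_of_projective hP h.injective a
  refine hs (h.exists_section (r := r - c ≫ b) ?_)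
  rw [Preadditive.comp_sub, ← Category.assoc, ← e]
  abel

theorem IsAlmostSplit.not_projective {f : A ⟶ B} {g : B ⟶ C} (h : IsAlmostSplit f g) :
    ¬ Module.Projective (MonoidAlgebra k G) A := by
  intro hA
  obtain ⟨r, hr⟩ := exists_extension_of_projective hA h.shortExact.injective (𝟙 A)
  exact h.not_split (h.shortExact.exists_section hr)

/-- An endomorphism of an almost split sequence that is the identity on the last term is a stable
isomorphism on the first term. -/
theorem IsAlmostSplit.isIso_map {f : A ⟶ B} {g : B ⟶ C} (h : IsAlmostSplit f g) {a : End A}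
    {b : End B} (hab : f ≫ b = (show A ⟶ A from a) ≫ f) (hb : (show B ⟶ B from b) ≫ g = g) :
    IsIso ((toSt (MonoidAlgebra k G)).map a) := by
  refine (h.indecomposable_left.isStablyLocal a).resolve_right ?_
  rintro ⟨n, hn⟩
  have h1 (n : ℕ) : f ≫ (show B ⟶ B from b ^ n) = (show A ⟶ A from a ^ n) ≫ f := by
    induction n with
    | zero => exact (Category.comp_id f).trans (Category.id_comp f).symm
    | succ n ih =>
      rw [pow_succ, pow_succ]
      change f ≫ b ≫ (show B ⟶ B from b ^ n) = (a ≫ (show A ⟶ A from a ^ n)) ≫ f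
      rw [← Category.assoc, hab, Category.assoc, ih, Category.assoc]
  have h2 (n : ℕ) : (show B ⟶ B from b ^ n) ≫ g = g := by
    induction n with
    | zero => exact Category.id_comp g
    | succ n ih =>
      rw [pow_succ]
      change (b ≫ (show B ⟶ B from b ^ n)) ≫ g = g
      rw [Category.assoc, ih, hb]
  -- If a power of `a` factors through a projective, subtracting an extension of that factorization
  -- from the same power of `b` leaves a map that descends to a section of `g`.
  obtain ⟨P, c, d, hP, e⟩ := toSt_map_eq_zero_iff.1 hn
  obtain ⟨c', rfl⟩ := exists_extension_of_projective hP h.shortExact.injective c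
  obtain ⟨s, hs⟩ := h.shortExact.exists_desc ((show B ⟶ B from b ^ n) - c' ≫ d ≫ f) (by
    rw [Preadditive.comp_sub, h1, e]; simp)
  refine h.not_split ⟨s, h.shortExact.cancel_epi ?_⟩
  rw [← Category.assoc, hs, Preadditive.sub_comp, h2]
  simp [h.shortExact.comp_eq_zero]

/-- The first term of an almost split sequence is stably isomorphic to the kernel of any right
almost split map with the same target, if that kernel is stably local. -/
theorem IsAlmostSplit.nonempty_iso {f : A ⟶ B} {g : B ⟶ C} (h : IsAlmostSplit f g) {f' : M ⟶ E}
    {g' : E ⟶ C} (h' : IsShortExact f' g') (hg' : IsRightAlmostSplit g') (hM : IsStablyLocal M) :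
    Nonempty ((toSt _).obj A ≅ (toSt _).obj M) := by
  obtain ⟨u, hu⟩ := hg'.2.2 B g h.not_split
  obtain ⟨v, hv⟩ := h.exists_lift E g' hg'.2.1
  obtain ⟨x, hx⟩ := h'.exists_codesc (f ≫ u) (by
    rw [Category.assoc, hu, h.shortExact.comp_eq_zero])
  obtain ⟨y, hy⟩ := h.shortExact.exists_codesc (f' ≫ v) (by
    rw [Category.assoc, hv, h'.comp_eq_zero])
  have hi : IsIso ((toSt (MonoidAlgebra k G)).map (x ≫ y)) := by
    refine h.isIso_map (a := x ≫ y) (b := u ≫ v) ?_ ?_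
    · change f ≫ u ≫ v = (x ≫ y) ≫ f
      rw [Category.assoc, hy, ← Category.assoc x, hx, Category.assoc]
    · change (u ≫ v) ≫ g = g
      rw [Category.assoc, hv, hu]
  -- Only the composite on the side of `A` is controlled; stable locality of `M` upgrades the split
  -- monomorphism to an isomorphism.
  have := isIso_of_comp_eq_id hM h.not_projective
    (x := (toSt _).map x) (y := (toSt _).map y ≫ inv ((toSt _).map (x ≫ y))) (by
      rw [← Category.assoc, ← Functor.map_comp, IsIso.hom_inv_id])
  exact ⟨asIso ((toSt _).map x)⟩

end GroupAlgebra

/-! ### Closure of the thick subcategory under Ω -/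

section Thick

variable {k G : Type u} [Field k] [Group G] [Finite G]
  {N : FGModuleCat.{u} (MonoidAlgebra k G)}

theorem thickSubcategory_syzygy (hN : thickSubcategory k G ((toSt _).obj N)) :
    thickSubcategory k G ((toSt _).obj (syzygy N)) := by
  intro T hT hk
  have hcover : T ((toSt _).obj (cover N)) := by
    have := hT.retracts
    -- A projective is a zero object stably, hence a retract of k through zero maps.
    refine T.prop_of_retract (Y := (toSt _).obj (trivialModule k G)) ⟨0, 0, ?_⟩ hk
    rw [Limits.zero_comp, ← CategoryTheory.Functor.map_id,
      toSt_map_id_eq_zero_iff.2 (projective_cover N)]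
  obtain ⟨β, γ, h1, h2⟩ := exists_map_shortExact (isShortExact_syzygy N)
    (isShortExact_cosyzygy (syzygy N)) (projective_hull _) (𝟙 _)
  refine hT.triangle₁ ((toSt _).map (syzygyι N)) ((toSt _).map (coverπ N)) ((toSt _).map γ)
    ⟨_, _, _, syzygyι N, coverπ N, Iso.refl _, Iso.refl _, Iso.refl _, isShortExact_syzygy N,
      by simp, by simp, 𝟙 _, β, γ, h1, h2, by simp, by simp⟩ hcover (hN T hT hk)

end Thick

/-! ### The connecting map: non-vanishing and ghost property -/

section Ghost

variable {k G : Type u} [Field k] [Group G] [Finite G]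
  {A B N : FGModuleCat.{u} (MonoidAlgebra k G)}

theorem IsAlmostSplit.isTriangleMap_ne_zero {f : A ⟶ B} {g : B ⟶ N} (h : IsAlmostSplit f g)
    {φ : (toSt (MonoidAlgebra k G)).obj N ⟶ (toSt (MonoidAlgebra k G)).obj (omega 1 N)}
    (hφ : IsTriangleMap f g φ) : φ ≠ 0 := by
  obtain ⟨θ, α, β, γ, h1, h2, h3, rfl⟩ := hφ
  intro h0
  obtain ⟨t, rfl⟩ : ∃ t : B ⟶ omega 2 N, f ≫ t = α :=
    h.shortExact.exists_extension_of_map_eq_zero (isShortExact_syzygy (omega 1 N)) h1 h2 h0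
  obtain ⟨α', hα'⟩ := (toSt _).map_surjective θ.inv
  refine not_exists_retraction h.shortExact h.not_split (r := t ≫ α') ?_
  have h4 : (toSt (MonoidAlgebra k G)).map (f ≫ t) = θ.hom := h3
  rw [← Category.assoc, Functor.map_comp, h4, hα', Iso.hom_inv_id]

/-- A lift of `x` to `B` makes the composite with the connecting map pass through the projective
middle term of the second sequence. -/
theorem IsAlmostSplit.comp_isTriangleMap {f : A ⟶ B} {g : B ⟶ N} (h : IsAlmostSplit f g)
    {φ : (toSt (MonoidAlgebra k G)).obj N ⟶ (toSt (MonoidAlgebra k G)).obj (omega 1 N)}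
    (hφ : IsTriangleMap f g φ) {M : FGModuleCat.{u} (MonoidAlgebra k G)} (x : M ⟶ N)
    (hx : ¬ ∃ s : N ⟶ M, s ≫ x = 𝟙 N) : (toSt (MonoidAlgebra k G)).map x ≫ φ = 0 := by
  obtain ⟨θ, α, β, γ, h1, h2, h3, rfl⟩ := hφ
  obtain ⟨y, rfl⟩ := h.exists_lift M x hx
  rw [← Functor.map_comp, Category.assoc, h2, ← Category.assoc]
  exact toSt_map_comp_eq_zero (projective_cover _) _ _

end Ghost

end StableModule

end
-- The main theorem
open StableModule

theorem corollary2p2 {k G : Type u} [Field k] [Group G] [Finite G]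
    (p : ℕ) [CharP k p] (hp : p ∣ Nat.card G)
    (N : FGModuleCat.{u} (MonoidAlgebra k G))
    (hN_ind : IsIndecomposable N)
    (hN_proj : ¬ Module.Projective (MonoidAlgebra k G) N)
    (hN_thick : thickSubcategory k G ((toSt (MonoidAlgebra k G)).obj N))
    (hN_omega : ∀ i : ℤ, ¬ Nonempty ((toSt (MonoidAlgebra k G)).obj N ≅
      (toSt (MonoidAlgebra k G)).obj (omega i (trivialModule k G)))) :
    ¬ GeneratingHypothesis k G ∧
    (∃ (A B : FGModuleCat.{u} (MonoidAlgebra k G)) (f : A ⟶ B) (g : B ⟶ N),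
      IsAlmostSplit f g) ∧
    ∀ (A B : FGModuleCat.{u} (MonoidAlgebra k G)) (f : A ⟶ B) (g : B ⟶ N),
      IsAlmostSplit f g →
        (∃ φ : (toSt (MonoidAlgebra k G)).obj N ⟶ (toSt (MonoidAlgebra k G)).obj (omega 1 N),
          IsTriangleMap f g φ) ∧
        ∀ φ : (toSt (MonoidAlgebra k G)).obj N ⟶ (toSt (MonoidAlgebra k G)).obj (omega 1 N),
          IsTriangleMap f g φ → φ ≠ 0 ∧ IsGhost φ := by
  obtain ⟨E, f₀, g₀, h₀, hg₀⟩ := exists_isRightAlmostSplit hN_ind hN_proj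
  have hex := hg₀.exists_isAlmostSplit hN_ind
  have main (A B : FGModuleCat.{u} (MonoidAlgebra k G)) (f : A ⟶ B) (g : B ⟶ N)
      (h : IsAlmostSplit f g) :
        (∃ φ : (toSt (MonoidAlgebra k G)).obj N ⟶ (toSt (MonoidAlgebra k G)).obj (omega 1 N),
          IsTriangleMap f g φ) ∧
        ∀ φ : (toSt (MonoidAlgebra k G)).obj N ⟶ (toSt (MonoidAlgebra k G)).obj (omega 1 N),
          IsTriangleMap f g φ → φ ≠ 0 ∧ IsGhost φ := by
    constructor
    · obtain ⟨θ⟩ := h.nonempty_iso h₀ hg₀ (hN_ind.isStablyLocal.omega 2)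
      obtain ⟨α, hα⟩ := (toSt _).map_surjective θ.hom
      obtain ⟨β, γ, h1, h2⟩ := exists_map_shortExact h.shortExact
        (isShortExact_syzygy (omega 1 N)) (projective_cover _) α
      exact ⟨(toSt _).map γ, θ, α, β, γ, h1, h2, hα, rfl⟩
    · intro φ hφ
      refine ⟨h.isTriangleMap_ne_zero hφ, hN_thick, thickSubcategory_syzygy hN_thick, ?_⟩
      refine funext fun i => AddCommGrpCat.hom_ext (AddMonoidHom.ext fun x => ?_)
      obtain ⟨x, rfl⟩ := (toSt _).map_surjective x
      change (toSt (MonoidAlgebra k G)).map x ≫ φ = 0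
      refine h.comp_isTriangleMap hφ x ?_
      -- A section would exhibit `N` as a stable retract of the stably local Ωⁱk, and so make it
      -- isomorphic to Ωⁱk.
      rintro ⟨s, hs⟩
      have := isIso_of_comp_eq_id ((isIndecomposable_trivialModule k G).isStablyLocal.omega i)
        hN_proj (x := (toSt _).map s) (y := (toSt _).map x) (by
          rw [← Functor.map_comp, hs, CategoryTheory.Functor.map_id])
      exact hN_omega i ⟨asIso ((toSt _).map s)⟩
  refine ⟨fun hGH => ?_, hex, main⟩
  obtain ⟨A, B, f, g, h⟩ := hex
  obtain ⟨⟨φ, hφ⟩, h2⟩ := main A B f g h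
  obtain ⟨hne, hgh⟩ := h2 φ hφ
  have hGH' : ((thickSubcategory k G).ι ⋙ totalTateCohomology k G).Faithful := hGH
  let X : (thickSubcategory k G).FullSubcategory := ⟨_, hgh.source_mem⟩
  let Y : (thickSubcategory k G).FullSubcategory := ⟨_, hgh.target_mem⟩
  let Φ : X ⟶ Y := ObjectProperty.homMk φ
  let O : X ⟶ Y := ObjectProperty.homMk 0
  have : Φ = O := hGH'.map_injective (by
    change (totalTateCohomology k G).map φ = (totalTateCohomology k G).map 0
    rw [hgh.tate_map_eq_zero]
    refine funext fun i => AddCommGrpCat.hom_ext (AddMonoidHom.ext fun x => ?_)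
    exact Limits.comp_zero.symm)
  exact hne (congrArg (fun w => w.hom) this)
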